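/- Let $\mathbf a$ be a Turing degree such that $\mathbf a\vee\mathbf 0'\ge_T\mathbf 0''$. Then for every set $B\subseteq\omega$ with $B\in\mathbf a$: (1) there is a set $A\in\mathbf a$ with $A\le_{uT(tu)}B$, that is, there is a Turing reduction $\Phi^B=A$ whose use function is dominated by every order function; (2) $B$ is wtt-equivalent to some dominant function $f\colon\omega\to\omega$, that is, to a function that dominates every recursive function. Here an order function is a recursive, nondecreasing, unbounded function $h\colon\omega\to\omega$; a function $f$ dominates a function $g$ if $g(n)\le f(n)$ for all but finitely many $n$; the use function of a reduction $\Phi^B=A$ assigns to $n$ the number $m+1$, where $m$ is the largest number queried by $\Phi$ in computing $A(0),\dots,A(n-1)$ (and $0$ if there are no queries); and $f\le_{wtt}g$ means that $f$ is computable by a Turing reduction with oracle $g$ whose use function is bounded by a recursive function ($f,g$ functions $\omega\to\omega$, sets being identified with their characteristic functions). -/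

import Mathlib

/-- Programs for oracle computations. The constructors are those of `Nat.RecursiveIn`;
`oracle` is the instruction which queries the oracle at the current input. -/
inductive OracleCode : Type
  | zero : OracleCode
  | succ : OracleCode
  | left : OracleCode
  | right : OracleCode
  | oracle : OracleCode
  | pair : OracleCode → OracleCode → OracleCode
  | comp : OracleCode → OracleCode → OracleCode
  | prec : OracleCode → OracleCode → OracleCode
  | rfind : OracleCode → OracleCode

namespace OracleCode

/-- The Gödel number of a program. -/
def encode : OracleCode → ℕ
  | zero => 0
  | succ => 1
  | left => 2
  | right => 3
  | oracle => 4
  | pair c d => 4 * Nat.pair (encode c) (encode d) + 5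
  | comp c d => 4 * Nat.pair (encode c) (encode d) + 6
  | prec c d => 4 * Nat.pair (encode c) (encode d) + 7
  | rfind c => 4 * encode c + 8

theorem encode_injective : Function.Injective encode := by
  intro c
  induction c with
  | zero | succ | left | right | oracle =>
    intro d h; cases d <;> simp only [encode] at h <;> first | rfl | omega
  | pair c d ihc ihd | comp c d ihc ihd | prec c d ihc ihd =>
    intro e h
    cases e <;> simp only [encode] at h <;> first
      | omega
      | (have h' := Nat.pair_eq_pair.1 (Nat.eq_of_mul_eq_mul_left four_pos (Nat.add_right_cancel h))
         rw [ihc h'.1, ihd h'.2])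
  | rfind c ih =>
    intro e h
    cases e <;> simp only [encode] at h <;> first
      | omega
      | rw [ih (Nat.eq_of_mul_eq_mul_left four_pos (Nat.add_right_cancel h))]

/-- The partial function computed by a program with oracle `X`. -/
def eval (X : ℕ → ℕ) : OracleCode → ℕ →. ℕ
  | zero => fun _ => Part.some 0
  | succ => fun n => Part.some (n + 1)
  | left => fun n => Part.some n.unpair.1
  | right => fun n => Part.some n.unpair.2
  | oracle => fun n => Part.some (X n)
  | pair c d => fun n => Nat.pair <$> eval X c n <*> eval X d n
  | comp c d => fun n => eval X d n >>= eval X c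
  | prec c d => fun p =>
      let (a, n) := Nat.unpair p
      n.rec (eval X c a) fun y IH => do
        let i ← IH
        eval X d (Nat.pair a (Nat.pair y i))
  | rfind c => fun a => Nat.rfind fun n => (fun m => m = 0) <$> eval X c (Nat.pair a n)

/-- The set of numbers at which the oracle `X` is queried while the program runs on a given
input (for a run which halts). -/
def queries (X : ℕ → ℕ) : OracleCode → ℕ → Set ℕ
  | zero, _ => ∅
  | succ, _ => ∅
  | left, _ => ∅
  | right, _ => ∅
  | oracle, n => {n}
  | pair c d, n => queries X c n ∪ queries X d n
  | comp c d, n => queries X d n ∪ {q | ∃ m ∈ eval X d n, q ∈ queries X c m}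
  | prec c d, p => queries X c p.unpair.1 ∪
      {q | ∃ y < p.unpair.2, ∃ i ∈ eval X (prec c d) (Nat.pair p.unpair.1 y),
        q ∈ queries X d (Nat.pair p.unpair.1 (Nat.pair y i))}
  | rfind c, a => {q | ∃ n, (∀ k < n, ∃ m ∈ eval X c (Nat.pair a k), m ≠ 0) ∧
      q ∈ queries X c (Nat.pair a n)}

/-- The use function: `use X c n` is `q + 1`, where `q` is the largest number queried by `c`
during the computations with inputs `0, ..., n - 1`, and `0` if there are no queries.
By `queries_finite`, the supremum is over a finite set whenever these computations halt. -/
noncomputable def use (X : ℕ → ℕ) (c : OracleCode) (n : ℕ) : ℕ :=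
  sSup {u | ∃ m < n, ∃ q ∈ queries X c m, u = q + 1}

/-- The program `c` with oracle `X` computes the total function `f`. -/
def Computes (X : ℕ → ℕ) (c : OracleCode) (f : ℕ → ℕ) : Prop :=
  ∀ n, eval X c n = Part.some (f n)

theorem eval_prec_succ (X : ℕ → ℕ) (c d : OracleCode) (a y : ℕ) :
    eval X (prec c d) (Nat.pair a (y + 1)) =
      eval X (prec c d) (Nat.pair a y) >>= fun i => eval X d (Nat.pair a (Nat.pair y i)) := by
  simp [eval]

theorem queries_finite (X : ℕ → ℕ) (c : OracleCode) :
    ∀ n, (eval X c n).Dom → (queries X c n).Finite := by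
  induction c with
  | zero | succ | left | right | oracle => intro n _; simp [queries]
  | pair c d ihc ihd =>
    intro n h
    obtain ⟨v, hv⟩ := Part.dom_iff_mem.1 h
    simp only [eval, Seq.seq, Part.map_eq_map, Part.mem_bind_iff, Part.mem_map_iff] at hv
    obtain ⟨_, ⟨x, hx, _⟩, y, hy, _⟩ := hv
    exact (ihc n (Part.dom_iff_mem.2 ⟨x, hx⟩)).union (ihd n (Part.dom_iff_mem.2 ⟨y, hy⟩))
  | comp c d ihc ihd =>
    intro n h
    obtain ⟨v, hv⟩ := Part.dom_iff_mem.1 h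
    obtain ⟨x, hx, hv⟩ := Part.mem_bind_iff.1 hv
    refine (ihd n (Part.dom_iff_mem.2 ⟨x, hx⟩)).union
      ((ihc x (Part.dom_iff_mem.2 ⟨v, hv⟩)).subset ?_)
    rintro q ⟨m, hm, hq⟩
    rwa [Part.mem_unique hm hx] at hq
  | prec c d ihc ihd =>
    intro p h
    obtain ⟨a, n, rfl⟩ : ∃ a n, Nat.pair a n = p := ⟨_, _, Nat.pair_unpair p⟩
    induction n with
    | zero =>
      refine (ihc a (by simpa [eval] using h)).subset ?_
      rintro q (hq | ⟨y, hy, _⟩)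
      · simpa using hq
      · simp at hy
    | succ n ih =>
      rw [eval_prec_succ] at h
      obtain ⟨v, hv⟩ := Part.dom_iff_mem.1 h
      simp only [Part.bind_eq_bind, Part.mem_bind_iff] at hv
      obtain ⟨i, hi, hv⟩ := hv
      refine ((ih (Part.dom_iff_mem.2 ⟨i, hi⟩)).union
        (ihd _ (Part.dom_iff_mem.2 ⟨v, hv⟩))).subset ?_
      rintro q (hq | ⟨y, hy, j, hj, hq⟩)
      · left; left; simpa using hq
      · simp only [Nat.unpair_pair] at hy hj hq
        rcases Nat.lt_succ_iff_lt_or_eq.1 hy with hy | rfl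
        · left; right; exact ⟨y, by simpa using hy, j, by simpa using hj, by simpa using hq⟩
        · right; rwa [Part.mem_unique hj hi] at hq
  | rfind c ih =>
    intro a h
    obtain ⟨v, hv⟩ := Part.dom_iff_mem.1 h
    obtain ⟨hv, hlt⟩ := Nat.mem_rfind.1 hv
    obtain ⟨x, hx, hx0⟩ := (Part.mem_map_iff _).1 hv
    have hdom : ∀ n ≤ v, (eval X c (Nat.pair a n)).Dom := by
      intro n hn
      rcases hn.lt_or_eq with hn | rfl
      · obtain ⟨y, hy, _⟩ := (Part.mem_map_iff _).1 (hlt hn)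
        exact Part.dom_iff_mem.2 ⟨y, hy⟩
      · exact Part.dom_iff_mem.2 ⟨x, hx⟩
    refine ((Set.finite_Iic v).biUnion fun n hn => ih _ (hdom n hn)).subset ?_
    rintro q ⟨n, hn, hq⟩
    refine Set.mem_biUnion (x := n) ?_ hq
    by_contra hlt'
    obtain ⟨m, hm, hm0⟩ := hn v (not_le.1 hlt')
    exact hm0 ((Part.mem_unique hm hx).trans (of_decide_eq_true hx0))

/-- Programs with oracle `X` compute exactly the partial functions recursive in `X`. -/
theorem exists_code_iff (X : ℕ → ℕ) (f : ℕ →. ℕ) :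
    (∃ c : OracleCode, eval X c = f) ↔ TuringReducible f (X : ℕ →. ℕ) := by
  rw [TuringReducible, RecursiveIn.iff_nat]
  constructor
  · rintro ⟨c, rfl⟩
    induction c with
    | zero => exact .zero
    | succ => exact .succ
    | left => exact .left
    | right => exact .right
    | oracle => exact .oracle _ rfl
    | pair c d ihc ihd => exact .pair ihc ihd
    | comp c d ihc ihd => exact .comp ihc ihd
    | prec c d ihc ihd => exact .prec ihc ihd
    | rfind c ih => exact .rfind ih
  · intro h
    induction h with
    | zero => exact ⟨zero, rfl⟩
    | succ => exact ⟨succ, rfl⟩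
    | left => exact ⟨left, rfl⟩
    | right => exact ⟨right, rfl⟩
    | oracle g hg => rw [Set.mem_singleton_iff.1 hg]; exact ⟨oracle, rfl⟩
    | pair _ _ ihc ihd =>
      obtain ⟨c, rfl⟩ := ihc; obtain ⟨d, rfl⟩ := ihd; exact ⟨pair c d, rfl⟩
    | comp _ _ ihc ihd =>
      obtain ⟨c, rfl⟩ := ihc; obtain ⟨d, rfl⟩ := ihd; exact ⟨comp c d, rfl⟩
    | prec _ _ ihc ihd =>
      obtain ⟨c, rfl⟩ := ihc; obtain ⟨d, rfl⟩ := ihd; exact ⟨prec c d, rfl⟩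
    | rfind _ ih => obtain ⟨c, rfl⟩ := ih; exact ⟨rfind c, rfl⟩

end OracleCode

open Classical in
/-- The characteristic function of a set of natural numbers. -/
noncomputable def charFn (A : Set ℕ) (n : ℕ) : ℕ := if n ∈ A then 1 else 0

/-- The Turing degree of a set. -/
noncomputable def degT (A : Set ℕ) : TuringDegree :=
  toAntisymmetrization TuringReducible (charFn A : ℕ →. ℕ)

theorem degT_le_degT_iff (A B : Set ℕ) :
    degT A ≤ degT B ↔ TuringReducible (charFn A : ℕ →. ℕ) (charFn B : ℕ →. ℕ) :=
  Iff.rfl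

/-- The Turing jump of a set: the numbers `e` such that the program with Gödel number `e` and
oracle `A` halts on input `e`. -/
def jump (A : Set ℕ) : Set ℕ :=
  {e | ∃ c : OracleCode, c.encode = e ∧ (c.eval (charFn A) e).Dom}

/-- An order function: a recursive, nondecreasing and unbounded function. -/
def IsOrder (h : ℕ → ℕ) : Prop :=
  Computable h ∧ Monotone h ∧ ¬ BddAbove (Set.range h)

/-- A function is dominant if it dominates every recursive function. -/
def IsDominant (f : ℕ → ℕ) : Prop :=
  ∀ g : ℕ → ℕ, Computable g → ∀ᶠ n in Filter.atTop, g n ≤ f n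

/-- Weak truth-table reducibility `f ≤_wtt g`: there is a Turing reduction of `f` to `g` whose
use function is bounded by a recursive function. -/
def WttReducible (f g : ℕ → ℕ) : Prop :=
  ∃ c : OracleCode, c.Computes g f ∧ ∃ h : ℕ → ℕ, Computable h ∧ ∀ n, c.use g n ≤ h n

/-- Weak truth-table equivalence. -/
def WttEquivalent (f g : ℕ → ℕ) : Prop :=
  WttReducible f g ∧ WttReducible g f

/-- `A ≤_{uT(tu)} B`: there is a Turing reduction of `A` to `B` whose use function is dominated
by every order function. -/
def UniformTinyUseReducible (A B : Set ℕ) : Prop :=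
  ∃ c : OracleCode, c.Computes (charFn B) (charFn A) ∧
    ∀ h : ℕ → ℕ, IsOrder h → ∀ᶠ n in Filter.atTop, c.use (charFn B) n ≤ h n

/-! Since `B` joined with `0'` computes `0''`, some program `Γ` decides totality of recursive
functions from `B ⊕ 0'`. Although `B` alone cannot run `Γ`, it can run it on finite approximations:
at stage `s`, the first `i` bits of `B`, the stage `s` approximation to `0'`, and searches cut off
after `s` steps. Let `f n` be the least stage `s` such that for all `e ≤ i ≤ n + 1` either the
`e`-th recursive function has converged at `i` to a value at most `s`, or the approximate `Γ` does
not declare it total. Such stages exist (`eventually_goodStage`): a total function converges, and on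
a nontotal one the approximations eventually stop claiming totality. Moreover `f` is dominant
(`isDominant_of_goodStage`): if the `e`-th function is total, then for large `n` the approximate `Γ`
says so, and the first alternative must hold.

Put `g n = 2 * (f n + n + 1) + B(n)`. It is dominant, strictly increasing, computable from the first
`n + 1` bits of `B`, and its parity returns `B`; hence `g` is wtt-equivalent to `B`. For (1) take
the graph of `g`. Whether `⟨n, v⟩` lies in it can be decided by finding the least `k` with `v ≤ g k`
(`exists_graph_code`), so the queries are bounded by an inverse of `g`. An inverse of a dominant
function grows more slowly than every order function (`eventually_use_le_of_isDominant`). -/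

namespace OracleCode

/-! ### Oracle-free programs and reading initial segments -/

/-- The program `c` computes the partial function `f` without ever querying its oracle. -/
def ComputesFreely (c : OracleCode) (f : ℕ →. ℕ) : Prop :=
  ∀ X, eval X c = f ∧ ∀ n, queries X c n = ∅

/-- Recursive pre- and post-processing can thus be attached to a reduction without affecting its
use. -/
theorem exists_computesFreely {f : ℕ →. ℕ} (hf : Nat.Partrec f) : ∃ c, ComputesFreely c f := by
  induction hf with
  | zero => exact ⟨zero, fun X => ⟨rfl, fun _ => rfl⟩⟩
  | succ => exact ⟨succ, fun X => ⟨rfl, fun _ => rfl⟩⟩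
  | left => exact ⟨left, fun X => ⟨rfl, fun _ => rfl⟩⟩
  | right => exact ⟨right, fun X => ⟨rfl, fun _ => rfl⟩⟩
  | pair _ _ ihc ihd =>
    obtain ⟨c, hc⟩ := ihc
    obtain ⟨d, hd⟩ := ihd
    refine ⟨pair c d, fun X => ⟨?_, fun n => ?_⟩⟩
    · simp only [eval, (hc X).1, (hd X).1]; rfl
    · simp [queries, (hc X).2, (hd X).2]
  | comp _ _ ihc ihd =>
    obtain ⟨c, hc⟩ := ihc
    obtain ⟨d, hd⟩ := ihd
    refine ⟨comp c d, fun X => ⟨?_, fun n => ?_⟩⟩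
    · simp only [eval, (hc X).1, (hd X).1]; rfl
    · simp [queries, (hc X).2, (hd X).2]
  | prec _ _ ihc ihd =>
    obtain ⟨c, hc⟩ := ihc
    obtain ⟨d, hd⟩ := ihd
    refine ⟨prec c d, fun X => ⟨?_, fun n => ?_⟩⟩
    · simp only [eval, (hc X).1, (hd X).1]; rfl
    · simp [queries, (hc X).2, (hd X).2]
  | rfind _ ih =>
    obtain ⟨c, hc⟩ := ih
    refine ⟨rfind c, fun X => ⟨?_, fun n => ?_⟩⟩
    · simp only [eval, (hc X).1]; rfl
    · simp [queries, (hc X).2]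

theorem exists_computesFreely_total {f : ℕ → ℕ} (hf : Computable f) :
    ∃ c, ComputesFreely c (f : ℕ →. ℕ) :=
  exists_computesFreely (Partrec.nat_iff.1 hf)

theorem ComputesFreely.eval_eq {c : OracleCode} {f : ℕ →. ℕ} (hc : ComputesFreely c f)
    (X : ℕ → ℕ) (n : ℕ) : eval X c n = f n := by rw [(hc X).1]

theorem ComputesFreely.queries_eq {c : OracleCode} {f : ℕ →. ℕ} (hc : ComputesFreely c f)
    (X : ℕ → ℕ) (n : ℕ) : queries X c n = ∅ := (hc X).2 n

theorem eval_comp_of_eval {X : ℕ → ℕ} {d : OracleCode} {n m : ℕ} (c : OracleCode)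
    (h : eval X d n = Part.some m) : eval X (comp c d) n = eval X c m := by
  simp only [eval, h]
  exact Part.bind_some _ _

theorem queries_comp_of_eval {X : ℕ → ℕ} {d : OracleCode} {n m : ℕ} (c : OracleCode)
    (h : eval X d n = Part.some m) :
    queries X (comp c d) n = queries X d n ∪ queries X c m := by
  simp [queries, h]

theorem eval_pair_of_eval {X : ℕ → ℕ} {c d : OracleCode} {n k m : ℕ}
    (hc : eval X c n = Part.some k) (hd : eval X d n = Part.some m) :
    eval X (pair c d) n = Part.some (Nat.pair k m) := by
  simp [eval, hc, hd, Seq.seq]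

/-- The list of the first `n` values of `X`. -/
def initSeg (X : ℕ → ℕ) (n : ℕ) : List ℕ := (List.range n).map X

/-- There is a program which computes the initial segments of its oracle and which queries
only the entries of the segment asked for. -/
theorem exists_initSeg_code : ∃ c : OracleCode, ∀ X n,
    eval X c n = Part.some (Encodable.encode (initSeg X n)) ∧ queries X c n ⊆ Set.Iio n := by
  obtain ⟨fst, hfst⟩ := exists_computesFreely_total (f := fun p => p.unpair.2.unpair.1)
    (Primrec.fst.comp (Primrec.unpair.comp (Primrec.snd.comp Primrec.unpair))).to_comp
  obtain ⟨snd, hsnd⟩ := exists_computesFreely_total (f := fun p => p.unpair.2.unpair.2)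
    (Primrec.snd.comp (Primrec.unpair.comp (Primrec.snd.comp Primrec.unpair))).to_comp
  obtain ⟨app, happ⟩ := exists_computesFreely_total (f := fun p =>
      Encodable.encode (((Encodable.decode p.unpair.2 : Option (List ℕ)).getD []) ++ [p.unpair.1]))
    (Primrec.encode.comp (Primrec.list_concat.comp
      (Primrec.option_getD.comp (Primrec.decode.comp (Primrec.snd.comp Primrec.unpair))
        (Primrec.const [])) (Primrec.fst.comp Primrec.unpair))).to_comp
  obtain ⟨inp, hinp⟩ := exists_computesFreely_total (f := fun n => Nat.pair 0 n)
    (Primrec₂.natPair.comp (Primrec.const 0) Primrec.id).to_comp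
  let step := comp app (pair (comp oracle fst) snd)
  have hpair : ∀ X y i, eval X (pair (comp oracle fst) snd) (Nat.pair 0 (Nat.pair y i)) =
      Part.some (Nat.pair (X y) i) := fun X y i => by
    refine eval_pair_of_eval ?_ (by simp [hsnd.eval_eq])
    rw [eval_comp_of_eval (m := y) _ (by simp [hfst.eval_eq])]
    rfl
  have hrec : ∀ X n, eval X (prec zero step) (Nat.pair 0 n) =
      Part.some (Encodable.encode (initSeg X n)) := by
    intro X n
    induction n with
    | zero => simp [eval, initSeg]
    | succ n ih =>
      rw [eval_prec_succ, ih]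
      simp only [Part.bind_eq_bind, Part.bind_some]
      rw [eval_comp_of_eval _ (hpair X _ _), happ.eval_eq]
      simp [initSeg, List.range_succ]
  refine ⟨comp (prec zero step) inp, fun X n => ⟨?_, ?_⟩⟩
  · rw [eval_comp_of_eval (m := Nat.pair 0 n) _ (by simp [hinp.eval_eq]), hrec]
  · rw [queries_comp_of_eval (m := Nat.pair 0 n) _ (by simp [hinp.eval_eq]), hinp.queries_eq]
    rintro q (hq | hq)
    · exact hq.elim
    · simp only [queries, Nat.unpair_pair, Set.empty_union] at hq
      obtain ⟨y, hy, i, hi, hq⟩ := hq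
      rw [queries_comp_of_eval _ (hpair X y i), happ.queries_eq] at hq
      rw [queries, queries_comp_of_eval (m := y) _ (by simp [hfst.eval_eq]), hfst.queries_eq,
        hsnd.queries_eq] at hq
      simp only [queries, Set.empty_union, Set.union_empty, Set.mem_singleton_iff] at hq
      exact hq ▸ hy

/-! ### Truncated computations from partial oracles -/

/-- Evaluation with a partial oracle `p`, where the unbounded searches are cut off after `s`
steps; queries outside the domain of `p` make the computation fail. -/
def truncEval (p : ℕ → Option ℕ) (s : ℕ) : OracleCode → ℕ → Option ℕ
  | zero, _ => some 0
  | succ, n => some (n + 1)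
  | left, n => some n.unpair.1
  | right, n => some n.unpair.2
  | oracle, n => p n
  | pair c d, n => (truncEval p s c n).bind fun x => (truncEval p s d n).map fun y => Nat.pair x y
  | comp c d, n => (truncEval p s d n).bind fun m => truncEval p s c m
  | prec c d, m => Nat.rec (truncEval p s c m.unpair.1) (fun y o =>
      o.bind fun i => truncEval p s d (Nat.pair m.unpair.1 (Nat.pair y i))) m.unpair.2
  -- The counter moves past nonzero values and stays at the first zero; the final test rejects a
  -- counter that has not reached a zero.
  | rfind c, a =>
      (Nat.rec (some 0) (fun _ o => o.bind fun i =>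
        (truncEval p s c (Nat.pair a i)).map fun m => if m = 0 then i else i + 1) s :
          Option ℕ).bind fun i =>
        (truncEval p s c (Nat.pair a i)).bind fun m => if m = 0 then some i else none

/-- The program is fixed, so the induction on it stays outside the primitive recursion, and every
search has the explicit bound `s`. This is what makes goodness of a stage decidable. -/
theorem primrec_truncEval {α : Type*} [Primcodable α] {p : α → ℕ → Option ℕ} {s : α → ℕ}
    (hp : Primrec₂ p) (hs : Primrec s) (c : OracleCode) :
    Primrec₂ fun a n => truncEval (p a) (s a) c n := by
  induction c with
  | zero => exact (Primrec.const (some 0)).to₂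
  | succ => exact (Primrec.option_some.comp (Primrec.succ.comp Primrec.snd)).to₂
  | left =>
    exact (Primrec.option_some.comp (Primrec.fst.comp (Primrec.unpair.comp Primrec.snd))).to₂
  | right =>
    exact (Primrec.option_some.comp (Primrec.snd.comp (Primrec.unpair.comp Primrec.snd))).to₂
  | oracle => exact hp
  | pair c d ihc ihd =>
    refine Primrec.option_bind ihc (Primrec.option_map (g := fun x : (α × ℕ) × ℕ => Nat.pair x.2)
      (ihd.comp (Primrec.fst.comp Primrec.fst) (Primrec.snd.comp Primrec.fst)) ?_).to₂
    exact Primrec₂.natPair.comp (Primrec.snd.comp Primrec.fst) Primrec.snd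
  | comp c d ihc ihd =>
    exact Primrec.option_bind ihd (ihc.comp₂ (Primrec.fst.comp₂ Primrec₂.left) Primrec₂.right)
  | prec c d ihc ihd =>
    have hu : Primrec fun x : α × ℕ => x.2.unpair := Primrec.unpair.comp Primrec.snd
    refine Primrec.nat_rec' (h := fun (x : α × ℕ) (z : ℕ × Option ℕ) => z.2.bind fun i =>
        truncEval (p x.1) (s x.1) d (Nat.pair x.2.unpair.1 (Nat.pair z.1 i)))
      (Primrec.snd.comp hu) (ihc.comp Primrec.fst (Primrec.fst.comp hu)) ?_
    refine Primrec.option_bind (Primrec.snd.comp Primrec.snd) ?_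
    exact ihd.comp (Primrec.fst.comp (Primrec.fst.comp Primrec.fst)) (Primrec₂.natPair.comp
      (Primrec.fst.comp (hu.comp (Primrec.fst.comp Primrec.fst)))
      (Primrec₂.natPair.comp (Primrec.fst.comp (Primrec.snd.comp Primrec.fst)) Primrec.snd))
  | rfind c ih =>
    refine Primrec.option_bind (Primrec.nat_rec'
      (h := fun (x : α × ℕ) (z : ℕ × Option ℕ) => z.2.bind fun i =>
        (truncEval (p x.1) (s x.1) c (Nat.pair x.2 i)).map fun m => if m = 0 then i else i + 1)
      (hs.comp Primrec.fst) (Primrec.const (some 0)) ?_) ?_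
    · refine Primrec.option_bind (Primrec.snd.comp Primrec.snd) (Primrec.option_map
        (g := fun (x : ((α × ℕ) × ℕ × Option ℕ) × ℕ) m => if m = 0 then x.2 else x.2 + 1)
        (ih.comp (Primrec.fst.comp (Primrec.fst.comp Primrec.fst)) (Primrec₂.natPair.comp
          (Primrec.snd.comp (Primrec.fst.comp Primrec.fst)) Primrec.snd)) ?_)
      exact Primrec.ite (Primrec.eq.comp Primrec.snd (Primrec.const 0))
        (Primrec.snd.comp Primrec.fst) (Primrec.succ.comp (Primrec.snd.comp Primrec.fst))
    · refine Primrec.option_bind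
        (g := fun (x : (α × ℕ) × ℕ) m => if m = 0 then some x.2 else none) (ih.comp
        (Primrec.fst.comp Primrec.fst) (Primrec₂.natPair.comp
          (Primrec.snd.comp Primrec.fst) Primrec.snd)) ?_
      exact Primrec.ite (Primrec.eq.comp Primrec.snd (Primrec.const 0))
        (Primrec.option_some.comp (Primrec.snd.comp Primrec.fst)) (Primrec.const none)

open Filter in
/-- If partial oracles `p i` converge pointwise to `X` (or, when `T` holds, eventually do not
contradict `X`), then so do the truncated computations to the computations from `X`. -/
theorem eventually_truncEval {ι : Type*} {l : Filter ι} {p : ι → ℕ → Option ℕ} {b : ι → ℕ}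
    {X : ℕ → ℕ} {T : Prop} (hb : Tendsto b l atTop)
    (hp : ∀ q, ∀ᶠ i in l, p i q = some (X q) ∨ T ∧ p i q = none) (c : OracleCode) :
    ∀ n v, v ∈ eval X c n →
      ∀ᶠ i in l, truncEval (p i) (b i) c n = some v ∨ T ∧ truncEval (p i) (b i) c n = none := by
  induction c with
  | zero | succ | left | right =>
    intro n v hv
    simp only [eval, Part.mem_some_iff] at hv
    simp [truncEval, hv]
  | oracle =>
    intro n v hv
    simp only [eval, Part.mem_some_iff] at hv
    simpa [truncEval, hv] using hp n
  | pair c d ihc ihd =>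
    intro n v hv
    simp only [eval, Seq.seq, Part.map_eq_map, Part.mem_bind_iff, Part.mem_map_iff] at hv
    obtain ⟨_, ⟨x, hx, rfl⟩, y, hy, rfl⟩ := hv
    filter_upwards [ihc n x hx, ihd n y hy] with i h₁ h₂
    rcases h₁ with h₁ | ⟨hT, h₁⟩ <;> rcases h₂ with h₂ | ⟨hT, h₂⟩ <;> simp_all [truncEval]
  | comp c d ihc ihd =>
    intro n v hv
    obtain ⟨x, hx, hv⟩ := Part.mem_bind_iff.1 hv
    filter_upwards [ihd n x hx, ihc x v hv] with i h₁ h₂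
    rcases h₁ with h₁ | ⟨hT, h₁⟩ <;> simp_all [truncEval]
  | prec c d ihc ihd =>
    intro m v hv
    obtain ⟨a, n, rfl⟩ : ∃ a n, Nat.pair a n = m := ⟨_, _, Nat.pair_unpair m⟩
    induction n generalizing v with
    | zero => simpa [truncEval] using ihc a v (by simpa [eval] using hv)
    | succ n ih =>
      rw [eval_prec_succ] at hv
      simp only [Part.bind_eq_bind, Part.mem_bind_iff] at hv
      obtain ⟨x, hx, hv⟩ := hv
      filter_upwards [ih x hx, ihd _ v hv] with i h₁ h₂
      simp only [truncEval, Nat.unpair_pair] at h₁ ⊢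
      rcases h₁ with h₁ | ⟨hT, h₁⟩ <;> simp_all
  | rfind c ih =>
    intro a v hv
    obtain ⟨hv, hlt⟩ := Nat.mem_rfind.1 hv
    obtain ⟨x, hx, hx0⟩ := (Part.mem_map_iff _).1 hv
    obtain rfl : x = 0 := of_decide_eq_true hx0
    have hsmall : ∀ᶠ i in l, ∀ k < v, (∃ m, m ≠ 0 ∧
        truncEval (p i) (b i) c (Nat.pair a k) = some m) ∨
          T ∧ truncEval (p i) (b i) c (Nat.pair a k) = none := by
      refine (Set.finite_Iio v).eventually_all.2 fun k hk => ?_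
      obtain ⟨y, hy, hy0⟩ := (Part.mem_map_iff _).1 (hlt hk)
      filter_upwards [ih _ y hy] with i hi
      exact hi.imp_left fun h => ⟨y, of_decide_eq_false hy0, h⟩
    filter_upwards [hsmall, ih _ 0 hx, hb.eventually_ge_atTop v] with i hi hiv hbi
    -- With `v` the true result of the search, the counter after `s` rounds is `min s v`, unless a
    -- query has failed.
    have key : ∀ s, (Nat.rec (some 0) (fun _ o => o.bind fun k =>
        (truncEval (p i) (b i) c (Nat.pair a k)).map fun m => if m = 0 then k else k + 1) s :
          Option ℕ) = some (min s v) ∨ T ∧ (Nat.rec (some 0) (fun _ o => o.bind fun k =>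
        (truncEval (p i) (b i) c (Nat.pair a k)).map fun m => if m = 0 then k else k + 1) s :
          Option ℕ) = none := by
      intro s
      induction s with
      | zero => simp
      | succ s ihs =>
        rcases ihs with h | ⟨hT, h⟩
        · simp only [h, Option.bind_some]
          rcases lt_or_ge s v with hs | hs
          · rw [min_eq_left hs.le, min_eq_left (Nat.succ_le_of_lt hs)]
            rcases hi s hs with ⟨m, hm0, hm⟩ | ⟨hT, hm⟩
            · simp [hm, hm0]
            · simp [hm, hT]
          · rw [min_eq_right hs, min_eq_right (hs.trans s.le_succ)]
            rcases hiv with hm | ⟨hT, hm⟩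
            · simp [hm]
            · simp [hm, hT]
        · right; simp [h, hT]
    simp only [truncEval]
    rcases key (b i) with h | ⟨hT, h⟩
    · rw [h, min_eq_right hbi]
      rcases hiv with hm | ⟨hT, hm⟩
      · simp [hm]
      · simp [hm, hT]
    · right; simp [h, hT]

end OracleCode

/-! ### Translating programs with the empty oracle into `Code` -/

open Nat.Partrec (Code)

namespace OracleCode

theorem encode_surjective : Function.Surjective encode := by
  intro n
  induction n using Nat.strong_induction_on with
  | _ n ih =>
    rcases lt_or_ge n 5 with hn | hn
    · interval_cases n
      exacts [⟨zero, rfl⟩, ⟨succ, rfl⟩, ⟨left, rfl⟩, ⟨right, rfl⟩, ⟨oracle, rfl⟩]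
    · have hm : (n - 5) / 4 < n := by omega
      have h₁ := ((n - 5) / 4).unpair_left_le
      have h₂ := ((n - 5) / 4).unpair_right_le
      obtain ⟨c, hc⟩ := ih _ (h₁.trans_lt hm)
      obtain ⟨d, hd⟩ := ih _ (h₂.trans_lt hm)
      obtain ⟨e, he⟩ := ih _ hm
      obtain h | h | h | h : (n - 5) % 4 = 0 ∨ (n - 5) % 4 = 1 ∨ (n - 5) % 4 = 2 ∨
        (n - 5) % 4 = 3 := by omega
      · exact ⟨pair c d, by rw [encode, hc, hd, Nat.pair_unpair]; omega⟩
      · exact ⟨comp c d, by rw [encode, hc, hd, Nat.pair_unpair]; omega⟩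
      · exact ⟨prec c d, by rw [encode, hc, hd, Nat.pair_unpair]; omega⟩
      · exact ⟨rfind e, by rw [encode, he]; omega⟩

/-- The oracle-free program obtained by answering all oracle queries with `0`. -/
def erase : OracleCode → Code
  | zero => .zero
  | succ => .succ
  | left => .left
  | right => .right
  | oracle => .zero
  | pair c d => .pair (erase c) (erase d)
  | comp c d => .comp (erase c) (erase d)
  | prec c d => .prec (erase c) (erase d)
  -- `Code.rfind'` starts its search at the second component of the input, hence the pairing with
  -- `0`.
  | rfind c => .comp (.rfind' (erase c)) (.pair .id .zero)

theorem eval_erase (c : OracleCode) : (erase c).eval = eval (fun _ => 0) c := by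
  induction c with
  | zero | succ | left | right | oracle => rfl
  | pair c d ihc ihd | comp c d ihc ihd | prec c d ihc ihd =>
    simp only [erase, Code.eval, eval, ihc, ihd]; rfl
  | rfind c ih =>
    funext a
    have h : (Code.pair .id .zero).eval a = Part.some (Nat.pair a 0) := by
      simp only [Code.eval, Code.eval_id]
      simp [Seq.seq, pure, PFun.pure]
    simp only [erase, Code.eval, eval] at h ⊢
    rw [h]
    simp [Nat.unpaired, ih, Part.map_id']

/-- The map which sends the Gödel number of a program to the program with its queries erased. -/
noncomputable def eraseNat (n : ℕ) : Code := erase (Function.surjInv encode_surjective n)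

theorem eraseNat_encode (c : OracleCode) : eraseNat (encode c) = erase c := by
  rw [eraseNat, encode_injective (Function.surjInv_eq encode_surjective (encode c))]

/-- One step of the course-of-values recursion which computes `eraseNat`. -/
def eraseStep (l : List Code) : Option Code :=
  -- The list holds all earlier values, so its length is the number being decoded. Number `4`, the
  -- oracle instruction, falls to the default `.zero`, as its erasure should.
  if l.length < 5 then some ([Code.zero, .succ, .left, .right].getD l.length .zero)
  else
    l[((l.length - 5) / 4).unpair.1]?.bind fun c =>
    l[((l.length - 5) / 4).unpair.2]?.bind fun d =>
    l[(l.length - 5) / 4]?.map fun e =>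
      if (l.length - 5) % 4 = 0 then .pair c d else if (l.length - 5) % 4 = 1 then .comp c d
      else if (l.length - 5) % 4 = 2 then .prec c d else .comp (.rfind' e) (.pair .id .zero)

theorem primrec_eraseStep : Primrec eraseStep := by
  have hlen : Primrec fun l : List Code => l.length - 5 :=
    Primrec.nat_sub.comp Primrec.list_length (Primrec.const 5)
  have hdiv : Primrec fun l : List Code => (l.length - 5) / 4 :=
    Primrec.nat_div.comp hlen (Primrec.const 4)
  have hmod : Primrec fun l : List Code => (l.length - 5) % 4 :=
    Primrec.nat_mod.comp hlen (Primrec.const 4)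
  refine Primrec.ite (Primrec.nat_lt.comp Primrec.list_length (Primrec.const 5))
    (Primrec.option_some.comp ((Primrec.list_getD Code.zero).comp
      (Primrec.const [Code.zero, .succ, .left, .right]) Primrec.list_length)) ?_
  refine Primrec.option_bind (Primrec.list_getElem?.comp Primrec.id
    (Primrec.fst.comp (Primrec.unpair.comp hdiv))) ?_
  refine Primrec.option_bind (Primrec.list_getElem?.comp Primrec.fst
    (Primrec.snd.comp (Primrec.unpair.comp (hdiv.comp Primrec.fst)))) ?_
  refine Primrec.option_map (g := fun (x : (List Code × Code) × Code) e =>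
      if (x.1.1.length - 5) % 4 = 0 then Code.pair x.1.2 x.2
      else if (x.1.1.length - 5) % 4 = 1 then Code.comp x.1.2 x.2
      else if (x.1.1.length - 5) % 4 = 2 then Code.prec x.1.2 x.2
      else Code.comp (.rfind' e) (.pair .id .zero))
    (Primrec.list_getElem?.comp (Primrec.fst.comp Primrec.fst)
      (hdiv.comp (Primrec.fst.comp Primrec.fst))) ?_
  have hl : Primrec fun x : ((List Code × Code) × Code) × Code => (x.1.1.1.length - 5) % 4 :=
    hmod.comp (Primrec.fst.comp (Primrec.fst.comp Primrec.fst))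
  have hc : Primrec fun x : ((List Code × Code) × Code) × Code => x.1.1.2 :=
    Primrec.snd.comp (Primrec.fst.comp Primrec.fst)
  have hd : Primrec fun x : ((List Code × Code) × Code) × Code => x.1.2 :=
    Primrec.snd.comp Primrec.fst
  exact Primrec.ite (Primrec.eq.comp hl (Primrec.const 0)) (Code.primrec₂_pair.comp hc hd)
    (Primrec.ite (Primrec.eq.comp hl (Primrec.const 1)) (Code.primrec₂_comp.comp hc hd)
      (Primrec.ite (Primrec.eq.comp hl (Primrec.const 2)) (Code.primrec₂_prec.comp hc hd)
        (Code.primrec₂_comp.comp (Code.primrec_rfind'.comp Primrec.snd)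
          (Primrec.const (Code.pair .id .zero)))))

theorem eraseStep_eq_some {f : ℕ → Code} {l : List Code} {m r : ℕ} (hr : r < 4)
    (hl : l = (List.range (4 * m + r + 5)).map f) :
    eraseStep l = some (if r = 0 then .pair (f m.unpair.1) (f m.unpair.2)
      else if r = 1 then .comp (f m.unpair.1) (f m.unpair.2)
      else if r = 2 then .prec (f m.unpair.1) (f m.unpair.2)
      else .comp (.rfind' (f m)) (.pair .id .zero)) := by
  have hlen : l.length = 4 * m + r + 5 := by simp [hl]
  have hget : ∀ k ≤ m, l[k]? = some (f k) := fun k hk => by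
    rw [hl, List.getElem?_map, List.getElem?_range (by omega)]
    rfl
  have hdiv : (l.length - 5) / 4 = m := by omega
  have hmod : (l.length - 5) % 4 = r := by omega
  rw [eraseStep, if_neg (by omega), hdiv, hmod, hget _ m.unpair_left_le,
    hget _ m.unpair_right_le, hget _ le_rfl]
  rfl

/-- Gödel numbers exceed those of immediate subprograms, so course-of-values recursion applies;
bijectivity of `encode` makes the chosen preimage the right one. -/
theorem primrec_eraseNat : Primrec eraseNat := by
  suffices Primrec₂ fun (_ : Unit) n => eraseNat n from this.comp (Primrec.const ()) Primrec.id
  refine Primrec.nat_strong_rec _ (primrec_eraseStep.comp Primrec.snd).to₂ fun _ n => ?_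
  obtain ⟨c, rfl⟩ := encode_surjective n
  rw [eraseNat_encode]
  cases c with
  | zero | succ | left | right | oracle => simp [eraseStep, encode, erase]
  | pair c d =>
    refine (eraseStep_eq_some (f := eraseNat) (m := (encode c).pair (encode d)) (r := 0)
      (by omega) rfl).trans ?_
    simp [eraseNat_encode, erase]
  | comp c d =>
    refine (eraseStep_eq_some (f := eraseNat) (m := (encode c).pair (encode d)) (r := 1)
      (by omega) rfl).trans ?_
    simp [eraseNat_encode, erase]
  | prec c d =>
    refine (eraseStep_eq_some (f := eraseNat) (m := (encode c).pair (encode d)) (r := 2)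
      (by omega) rfl).trans ?_
    simp [eraseNat_encode, erase]
  | rfind c =>
    refine (eraseStep_eq_some (f := eraseNat) (m := encode c) (r := 3)
      (by omega) rfl).trans ?_
    simp [eraseNat_encode, erase]

/-! ### Jumps, the halting problem and totality -/

/-- The program with constant output `k`. -/
def const : ℕ → OracleCode
  | 0 => zero
  | k + 1 => comp succ (const k)

theorem eval_const (X : ℕ → ℕ) (k n : ℕ) : eval X (const k) n = Part.some k := by
  induction k with
  | zero => rfl
  | succ k ih => rw [const, eval_comp_of_eval _ ih]; rfl

theorem primrec_encode_comp_const (c : OracleCode) :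
    Primrec fun k => encode (comp c (const k)) := by
  have h : Primrec fun k => encode (const k) := by
    refine (Primrec.nat_rec₁ (f := fun _ x => 4 * Nat.pair 1 x + 6) 0 ?_).of_eq fun k => ?_
    · exact (Primrec.nat_add.comp (Primrec.nat_mul.comp (Primrec.const 4)
        (Primrec₂.natPair.comp (Primrec.const 1) Primrec.snd)) (Primrec.const 6)).to₂
    · induction k with
      | zero => rfl
      | succ k ih => simp only [const, encode, ← ih]
  exact Primrec.nat_add.comp (Primrec.nat_mul.comp (Primrec.const 4)
    (Primrec₂.natPair.comp (Primrec.const _) h)) (Primrec.const 6)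

end OracleCode

open OracleCode

/-- The jump asks only about a program run on its own number; hard-wiring the input `k` turns
halting on an arbitrary input into such a question. -/
theorem encode_comp_const_mem_jump_iff (A : Set ℕ) (c : OracleCode) (k : ℕ) :
    encode (comp c (const k)) ∈ jump A ↔ (c.eval (charFn A) k).Dom := by
  constructor
  · rintro ⟨d, hd, h⟩
    rw [encode_injective hd, eval_comp_of_eval _ (eval_const _ _ _)] at h
    exact h
  · intro h
    exact ⟨_, rfl, by rwa [eval_comp_of_eval _ (eval_const _ _ _)]⟩

/-- The computable approximation to the halting problem at stage `s`. -/
noncomputable def haltingApprox (s n : ℕ) : ℕ :=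
  if ((eraseNat n).evaln s n).isSome then 1 else 0

theorem primrec_haltingApprox : Primrec₂ haltingApprox := by
  refine Primrec.ite ?_ (Primrec.const 1) (Primrec.const 0)
  refine Primrec.eq.comp (Primrec.option_isSome.comp (Code.primrec_evaln.comp
    (Primrec.pair (Primrec.pair Primrec.fst (primrec_eraseNat.comp Primrec.snd)) Primrec.snd)))
    (Primrec.const true)

open Filter in
theorem eventually_haltingApprox (n : ℕ) :
    ∀ᶠ s in atTop, haltingApprox s n = charFn (jump ∅) n := by
  obtain ⟨c, rfl⟩ := encode_surjective n
  have hzero : charFn ∅ = fun _ => 0 := by funext; simp [charFn]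
  have hmem : encode c ∈ jump ∅ ↔ ((erase c).eval (encode c)).Dom := by
    rw [eval_erase]
    constructor
    · rintro ⟨d, hd, h⟩
      rwa [encode_injective hd, hzero] at h
    · exact fun h => ⟨c, rfl, by rwa [hzero]⟩
  by_cases h : encode c ∈ jump ∅
  · obtain ⟨x, hx⟩ := Part.dom_iff_mem.1 (hmem.1 h)
    obtain ⟨k, hk⟩ := Code.evaln_complete.1 hx
    filter_upwards [eventually_ge_atTop k] with s hs
    have : (erase c).evaln s (encode c) = some x := Code.evaln_mono hs hk
    simp [haltingApprox, charFn, h, eraseNat_encode, this]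
  · refine Eventually.of_forall fun s => ?_
    have : (erase c).evaln s (encode c) = none := by
      refine Option.eq_none_iff_forall_not_mem.2 fun x hx => h (hmem.2 ?_)
      exact Part.dom_iff_mem.2 ⟨x, Code.evaln_sound hx⟩
    simp [haltingApprox, charFn, h, eraseNat_encode, this]

/-- Non-totality of recursive functions is many-one reducible to the second jump. -/
theorem exists_primrec_mem_jump_jump_iff : ∃ r : ℕ → ℕ, Primrec r ∧ ∀ e,
    r e ∈ jump (jump ∅) ↔ ∃ n, ¬ ((Denumerable.ofNat Code e).eval n).Dom := by
  obtain ⟨u, hu⟩ := exists_computesFreely (f := fun m =>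
      (Denumerable.ofNat Code m.unpair.1).eval m.unpair.2) (Partrec.nat_iff.1 <|
    Code.eval_part.comp ((Primrec.ofNat Code).comp (Primrec.fst.comp Primrec.unpair)).to_comp
      (Primrec.snd.comp Primrec.unpair).to_comp)
  obtain ⟨t, ht⟩ := exists_computesFreely_total (primrec_encode_comp_const u).to_comp
  -- With oracle `0'`, this program searches for an input on which the `e`-th function diverges.
  refine ⟨_, primrec_encode_comp_const (rfind (comp oracle t)), fun e => ?_⟩
  have hhalt : ∀ n, charFn (jump ∅) (encode (comp u (const (Nat.pair e n)))) = 0 ↔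
      ¬ ((Denumerable.ofNat Code e).eval n).Dom := fun n => by
    have := encode_comp_const_mem_jump_iff ∅ u (Nat.pair e n)
    rw [hu.eval_eq, Nat.unpair_pair] at this
    simp [charFn, this]
  rw [encode_comp_const_mem_jump_iff]
  simp only [eval, ← hhalt]
  refine Nat.rfind_dom.trans (exists_congr fun n => ?_)
  simp [ht.eval_eq]

/-! ### Joins and finite oracle segments -/

/-- The join of two functions: `f` on the even and `g` on the odd numbers. -/
def joinFn (f g : ℕ → ℕ) (n : ℕ) : ℕ := if n % 2 = 0 then f (n / 2) else g (n / 2)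

theorem turingReducible_of_eq_comp {f g k : ℕ → ℕ} (hk : Computable k) (h : ∀ n, f n = g (k n)) :
    TuringReducible (f : ℕ →. ℕ) (g : ℕ →. ℕ) := by
  obtain ⟨c, hc⟩ := exists_computesFreely_total hk
  refine (exists_code_iff g f).1 ⟨comp oracle c, funext fun n => ?_⟩
  rw [eval_comp_of_eval _ (hc.eval_eq _ _)]
  simp [eval, h]

theorem turingReducible_joinFn_left (f g : ℕ → ℕ) :
    TuringReducible (f : ℕ →. ℕ) (joinFn f g : ℕ →. ℕ) :=
  turingReducible_of_eq_comp (k := fun n => 2 * n)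
    (Primrec.nat_mul.comp (Primrec.const 2) Primrec.id).to_comp fun n => by simp [joinFn]

theorem turingReducible_joinFn_right (f g : ℕ → ℕ) :
    TuringReducible (g : ℕ →. ℕ) (joinFn f g : ℕ →. ℕ) :=
  turingReducible_of_eq_comp (k := fun n => 2 * n + 1)
    (Primrec.succ.comp (Primrec.nat_mul.comp (Primrec.const 2) Primrec.id)).to_comp fun n => by
      have h₁ : (2 * n + 1) % 2 = 1 := by omega
      have h₂ : (2 * n + 1) / 2 = n := by omega
      simp [joinFn, h₁, h₂]

theorem length_initSeg (X : ℕ → ℕ) (n : ℕ) : (initSeg X n).length = n := by simp [initSeg]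

theorem take_initSeg (X : ℕ → ℕ) {i n : ℕ} (h : i ≤ n) :
    (initSeg X n).take i = initSeg X i := by
  simp [initSeg, ← List.map_take, List.take_range, h]

theorem initSeg_getElem?_of_lt (X : ℕ → ℕ) {q n : ℕ} (h : q < n) :
    (initSeg X n)[q]? = some (X q) := by
  simp [initSeg, h]

theorem initSeg_getElem?_of_le (X : ℕ → ℕ) {q n : ℕ} (h : n ≤ q) :
    (initSeg X n)[q]? = none := by
  simp [initSeg, h]

/-! ### Good stages and the dominant function -/

/-- The stage `s` approximation to the join of the finite sequence `l` with the halting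
problem. -/
noncomputable def stageOracle (l : List ℕ) (s q : ℕ) : Option ℕ :=
  if q % 2 = 0 then l[q / 2]? else some (haltingApprox s (q / 2))

theorem primrec_stageOracle :
    Primrec₂ fun (x : List ℕ × ℕ) q => stageOracle x.1 x.2 q := by
  have hq : Primrec fun x : (List ℕ × ℕ) × ℕ => x.2 / 2 :=
    Primrec.nat_div.comp Primrec.snd (Primrec.const 2)
  exact Primrec.ite
    (Primrec.eq.comp (Primrec.nat_mod.comp Primrec.snd (Primrec.const 2)) (Primrec.const 0))
    (Primrec.list_getElem?.comp (Primrec.fst.comp Primrec.fst) hq)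
    (Primrec.option_some.comp (primrec_haltingApprox.comp (Primrec.snd.comp Primrec.fst) hq))

/-- At stage `s`, the program with number `e` has been seen to halt on input `i` with an output
of size at most `s`, unless the computation of `Γ` from `l` and the stage `s` approximation to
the halting problem does not claim that this program is total. -/
def Settled (Γ : OracleCode) (r : ℕ → ℕ) (s : ℕ) (l : List ℕ) (i e : ℕ) : Prop :=
  -- The default `s + 1` makes an unfinished run violate the bound.
  ((Denumerable.ofNat Code e).evaln s i).getD (s + 1) ≤ s ∨
    truncEval (stageOracle l s) s Γ (r e) ≠ some 0

/-- The stage `s` is good for `l` if everything relevant to the initial segments of `l` is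
settled. -/
def GoodStage (Γ : OracleCode) (r : ℕ → ℕ) (l : List ℕ) (s : ℕ) : Prop :=
  ∀ i < l.length + 1, i ≤ s ∧ ∀ e < i + 1, Settled Γ r s (l.take i) i e

theorem primrecRel_forall_lt {β : Type*} [Primcodable β] {R : ℕ → β → Prop}
    (hR : PrimrecRel R) : PrimrecRel fun n y => ∀ x < n, R x y :=
  (hR.forall_mem_list.comp (Primrec.list_range.comp Primrec.fst) Primrec.snd).of_eq (by simp)

theorem primrecRel_goodStage (Γ : OracleCode) {r : ℕ → ℕ} (hr : Primrec r) :
    PrimrecRel (GoodStage Γ r) := by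
  have hsettled : PrimrecRel fun (e : ℕ) (y : ℕ × List ℕ × ℕ) =>
      Settled Γ r y.2.2 (y.2.1.take y.1) y.1 e := by
    have hi : Primrec fun x : ℕ × ℕ × List ℕ × ℕ => x.2.1 := Primrec.fst.comp Primrec.snd
    have hl : Primrec fun x : ℕ × ℕ × List ℕ × ℕ => x.2.2.1 :=
      Primrec.fst.comp (Primrec.snd.comp Primrec.snd)
    have hs : Primrec fun x : ℕ × ℕ × List ℕ × ℕ => x.2.2.2 :=
      Primrec.snd.comp (Primrec.snd.comp Primrec.snd)
    have htrunc : Primrec₂ fun (x : List ℕ × ℕ) n => truncEval (stageOracle x.1 x.2) x.2 Γ n :=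
      primrec_truncEval primrec_stageOracle Primrec.snd Γ
    refine PrimrecPred.or ?_ (PrimrecPred.not ?_)
    · exact Primrec.nat_le.comp (Primrec.option_getD.comp (Code.primrec_evaln.comp
        (Primrec.pair (Primrec.pair hs ((Primrec.ofNat Code).comp Primrec.fst)) hi))
        (Primrec.succ.comp hs)) hs
    · exact Primrec.eq.comp (htrunc.comp (Primrec.pair (Primrec.list_take.comp hi hl) hs)
        (hr.comp Primrec.fst)) (Primrec.const (some 0))
  have hall : PrimrecPred fun x : ℕ × List ℕ × ℕ =>
      ∀ e < x.1 + 1, Settled Γ r x.2.2 (x.2.1.take x.1) x.1 e :=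
    (primrecRel_forall_lt hsettled).comp (Primrec.succ.comp Primrec.fst) Primrec.id
  have hinner : PrimrecRel fun (i : ℕ) (y : List ℕ × ℕ) =>
      i ≤ y.2 ∧ ∀ e < i + 1, Settled Γ r y.2 (y.1.take i) i e :=
    PrimrecPred.and (Primrec.nat_le.comp Primrec.fst (Primrec.snd.comp Primrec.snd)) hall
  exact (primrecRel_forall_lt hinner).comp
    (Primrec.succ.comp (Primrec.list_length.comp Primrec.fst)) Primrec.id

open Filter

theorem eventually_goodStage {b : ℕ → ℕ} {Γ : OracleCode} {r : ℕ → ℕ}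
    (hΓ : Γ.Computes (joinFn b (charFn (jump ∅))) (charFn (jump (jump ∅))))
    (hr : ∀ e, r e ∈ jump (jump ∅) ↔ ∃ n, ¬ ((Denumerable.ofNat Code e).eval n).Dom) (n : ℕ) :
    ∀ᶠ s in atTop, GoodStage Γ r (initSeg b n) s := by
  refine (Set.finite_Iio _).eventually_all.2 fun i hi => (eventually_ge_atTop i).and ?_
  refine (Set.finite_Iio _).eventually_all.2 fun e _ => ?_
  rw [take_initSeg _ (by simpa [length_initSeg, Nat.lt_succ_iff] using hi)]
  by_cases he : r e ∈ jump (jump ∅)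
  · have hval : 1 ∈ Γ.eval (joinFn b (charFn (jump ∅))) (r e) := by
      rw [hΓ (r e)]; simp [charFn, he]
    -- Only `i` bits are available here, so a query may fail at every stage; `T := True` allows
    -- this, since failure is not the answer `0` either.
    have := eventually_truncEval (p := fun s => stageOracle (initSeg b i) s) (T := True)
      tendsto_id (fun q => ?_) Γ _ _ hval
    · filter_upwards [this] with s hs
      right
      rcases hs with hs | ⟨-, hs⟩ <;> simp only [id] at hs <;> simp [hs]
    · filter_upwards [eventually_haltingApprox (q / 2)] with s hs
      simp only [stageOracle, joinFn]
      split_ifs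
      · rcases lt_or_ge (q / 2) i with h | h
        · exact .inl (initSeg_getElem?_of_lt b h)
        · exact .inr ⟨trivial, initSeg_getElem?_of_le b h⟩
      · simp [hs]
  · have hdom : ((Denumerable.ofNat Code e).eval i).Dom := by
      by_contra h
      exact he ((hr e).2 ⟨i, h⟩)
    obtain ⟨x, hx⟩ := Part.dom_iff_mem.1 hdom
    obtain ⟨k, hk⟩ := Code.evaln_complete.1 hx
    filter_upwards [eventually_ge_atTop k, eventually_ge_atTop x] with s hs hxs
    left
    rw [Option.mem_def.1 (Code.evaln_mono hs hk)]
    exact hxs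

theorem isDominant_of_goodStage {b f : ℕ → ℕ} {Γ : OracleCode} {r : ℕ → ℕ}
    (hΓ : Γ.Computes (joinFn b (charFn (jump ∅))) (charFn (jump (jump ∅))))
    (hr : ∀ e, r e ∈ jump (jump ∅) ↔ ∃ n, ¬ ((Denumerable.ofNat Code e).eval n).Dom)
    (hf : ∀ n, GoodStage Γ r (initSeg b (n + 1)) (f n)) : IsDominant f := by
  intro h hh
  have hlt : ∀ n, n < (initSeg b (n + 1)).length + 1 := fun n => by
    rw [length_initSeg]; omega
  have hle : ∀ n, n ≤ f n := fun n => (hf n n (hlt n)).1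
  have htend : Tendsto f atTop atTop := tendsto_atTop_mono hle tendsto_id
  obtain ⟨c, hc⟩ := Code.exists_code.1 (Partrec.nat_iff.1 hh)
  have hce : Denumerable.ofNat Code (Encodable.encode c) = c := Denumerable.ofNat_encode c
  have hmem : r (Encodable.encode c) ∉ jump (jump ∅) := by
    rw [hr, hce, hc]; simp
  have hval : 0 ∈ Γ.eval (joinFn b (charFn (jump ∅))) (r (Encodable.encode c)) := by
    rw [hΓ]; simp [charFn, hmem]
  -- Here the segments exhaust `b` and the stages tend to infinity, so no query fails in the limit
  -- and `T := False` applies.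
  have := eventually_truncEval (p := fun n => stageOracle (initSeg b n) (f n)) (T := False)
      htend (fun q => ?_) Γ _ _ hval
  · filter_upwards [this, eventually_ge_atTop (Encodable.encode c)] with n hn hcn
    rcases (hf n n (hlt n)).2 _ (Nat.lt_succ_of_le hcn) with hs | hs
    · rw [hce] at hs
      cases hx : c.evaln (f n) n with
      | none => simp [hx] at hs
      | some x =>
        have : x ∈ c.eval n := Code.evaln_sound hx
        rw [hc] at this
        rw [hx] at hs
        obtain rfl : x = h n := by simpa using this
        simpa using hs
    · rw [take_initSeg _ n.le_succ] at hs
      exact (hs (by simpa using hn)).elim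
  · filter_upwards [htend.eventually (eventually_haltingApprox (q / 2)),
      eventually_gt_atTop (q / 2)] with n hn hq
    left
    simp only [stageOracle, joinFn]
    split_ifs
    · exact initSeg_getElem?_of_lt b hq
    · rw [hn]

/-- A set which, joined with the halting problem, computes the second jump also computes a
strictly increasing dominant function whose `n`-th value depends only on the first `n + 1` bits
of the set and codes the last of them. -/
theorem exists_dominant_of_computes_jump_jump {B : Set ℕ} {Γ : OracleCode}
    (hΓ : Γ.Computes (joinFn (charFn B) (charFn (jump ∅))) (charFn (jump (jump ∅)))) :
    ∃ (G : List ℕ →. ℕ) (g : ℕ → ℕ), Partrec G ∧ StrictMono g ∧ IsDominant g ∧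
      (∀ n, G (initSeg (charFn B) (n + 1)) = Part.some (g n)) ∧ ∀ n, g n % 2 = charFn B n := by
  classical
  obtain ⟨r, hrp, hr⟩ := exists_primrec_mem_jump_jump_iff
  have hex := fun n => (eventually_goodStage hΓ hr n).exists
  have hlast : ∀ n, charFn B n ≤ 1 := fun n => by unfold charFn; split_ifs <;> simp
  let f : ℕ → ℕ := fun n => Nat.find (hex (n + 1))
  have hf : ∀ n, GoodStage Γ r (initSeg (charFn B) (n + 1)) (f n) := fun n => Nat.find_spec _
  -- A stage good for a longer segment is good for a shorter one, because each condition mentions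
  -- only `l.take i`.
  have hmono : Monotone f := by
    refine monotone_nat_of_le_succ fun n => Nat.find_min' _ fun i hi => ?_
    rw [length_initSeg] at hi
    have := hf (n + 1) i (by rw [length_initSeg]; omega)
    rwa [take_initSeg _ (by omega)] at this ⊢
  -- Doubling leaves the parity free to hold the last bit, and adding the length makes the increase
  -- strict.
  let G : List ℕ →. ℕ := fun l =>
    (Nat.rfind fun s => Part.some (decide (GoodStage Γ r l s))).map fun s =>
      2 * (s + l.length) + (l[l.length - 1]?).getD 0
  refine ⟨G, fun n => 2 * (f n + (n + 1)) + charFn B n, ?_, ?_, ?_, fun n => ?_, fun n => ?_⟩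
  · refine Partrec.map (Partrec.rfind
      (Primrec.to_comp (primrecPred_iff_primrec_decide.1 (primrecRel_goodStage Γ hrp))).partrec)
      (Primrec.to_comp ?_)
    have hlen : Primrec fun x : List ℕ × ℕ => x.1.length := Primrec.list_length.comp Primrec.fst
    exact Primrec.nat_add.comp (Primrec.nat_mul.comp (Primrec.const 2)
      (Primrec.nat_add.comp Primrec.snd hlen)) (Primrec.option_getD.comp
        (Primrec.list_getElem?.comp Primrec.fst (Primrec.nat_sub.comp hlen (Primrec.const 1)))
        (Primrec.const 0))
  · refine strictMono_nat_of_lt_succ fun n => ?_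
    have := hmono n.le_succ
    have := hlast n
    simp only [Nat.succ_eq_add_one] at *
    omega
  · intro h hh
    filter_upwards [isDominant_of_goodStage hΓ hr hf h hh] with n hn
    omega
  · have : (Nat.rfind fun s => Part.some
        (decide (GoodStage Γ r (initSeg (charFn B) (n + 1)) s))) = Part.some (f n) := by
      refine Part.eq_some_iff.2 (Nat.mem_rfind.2 ⟨?_, fun {m} hm => ?_⟩)
      · simpa using hf n
      · simpa using Nat.find_min (hex (n + 1)) hm
    simp only [G, this, Part.map_some, length_initSeg, Nat.add_sub_cancel,
      initSeg_getElem?_of_lt _ n.lt_succ_self, Option.getD_some]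
  · have := hlast n
    change (2 * (f n + (n + 1)) + charFn B n) % 2 = charFn B n
    omega

/-! ### Bounds on the use and the graph of the dominant function -/

namespace OracleCode

theorem use_le {X : ℕ → ℕ} {c : OracleCode} {n N : ℕ}
    (h : ∀ m < n, ∀ q ∈ queries X c m, q < N) : use X c n ≤ N := by
  refine csSup_le' ?_
  rintro _ ⟨m, hm, q, hq, rfl⟩
  exact h m hm q hq

theorem exists_code_of_initSeg {X f : ℕ → ℕ} {G : List ℕ →. ℕ} (hG : Partrec G)
    (h : ∀ n, G (initSeg X (n + 1)) = Part.some (f n)) :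
    ∃ c : OracleCode, c.Computes X f ∧ ∀ n, queries X c n ⊆ Set.Iic n := by
  obtain ⟨seg, hseg⟩ := exists_initSeg_code
  obtain ⟨c, hc⟩ := exists_computesFreely hG
  have hs : ∀ n, eval X (comp seg succ) n = Part.some (Encodable.encode (initSeg X (n + 1))) :=
    fun n => (eval_comp_of_eval (m := n + 1) _ rfl).trans (hseg X _).1
  refine ⟨comp c (comp seg succ), fun n => ?_, fun n => ?_⟩
  · rw [eval_comp_of_eval _ (hs n), hc.eval_eq]
    simp [h]
  · rw [queries_comp_of_eval _ (hs n), hc.queries_eq,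
      queries_comp_of_eval (m := n + 1) seg rfl]
    rintro q ((hq | hq) | hq)
    · exact hq.elim
    · exact Nat.lt_succ_iff.1 ((hseg X _).2 hq)
    · exact hq.elim

/-- If `g` is strictly increasing and `g n` can be computed with queries up to `n` only, then
the graph of `g` can be decided at `⟨n, v⟩` with queries up to the least `k` with `v ≤ g k`. -/
theorem exists_graph_code {X g : ℕ → ℕ} (hg : StrictMono g) {c : OracleCode}
    (hc : c.Computes X g) (hq : ∀ n, queries X c n ⊆ Set.Iic n) :
    ∃ d : OracleCode, d.Computes X (charFn {m | g m.unpair.1 = m.unpair.2}) ∧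
      ∀ m, ∀ q ∈ queries X d m, ∀ k < q, g k < m.unpair.2 := by
  classical
  obtain ⟨sub, hsub⟩ := exists_computesFreely_total (f := fun p => p.unpair.1.unpair.2 - p.unpair.2)
    (Primrec.nat_sub.comp (Primrec.snd.comp (Primrec.unpair.comp (Primrec.fst.comp Primrec.unpair)))
      (Primrec.snd.comp Primrec.unpair)).to_comp
  obtain ⟨idc, hid⟩ := exists_computesFreely_total (f := fun n => n) Computable.id
  obtain ⟨fin, hfin⟩ := exists_computesFreely_total (f := fun p =>
      if p.unpair.1 = p.unpair.2 then 1 else 0) (Primrec.ite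
        (Primrec.eq.comp (Primrec.fst.comp Primrec.unpair) (Primrec.snd.comp Primrec.unpair))
        (Primrec.const 1) (Primrec.const 0)).to_comp
  -- On `⟨m, k⟩` with `m = ⟨n, v⟩` this returns `v - g k`, which is zero exactly when `v ≤ g k`.
  -- Computing `g n` outright could query up to `n`, which is too much when `v` is small.
  let test := comp sub (pair left (comp c right))
  have hright : ∀ m k, eval X (comp c right) (Nat.pair m k) = Part.some (g k) := fun m k => by
    rw [eval_comp_of_eval (m := k) _ (by simp [eval]), hc k]
  have hpair : ∀ m k, eval X (pair left (comp c right)) (Nat.pair m k) =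
      Part.some (Nat.pair m (g k)) := fun m k =>
    eval_pair_of_eval (by simp [eval]) (hright m k)
  have htest : ∀ m k, eval X test (Nat.pair m k) = Part.some (m.unpair.2 - g k) := fun m k => by
    rw [eval_comp_of_eval _ (hpair m k), hsub.eval_eq]
    simp
  have htestq : ∀ m k, queries X test (Nat.pair m k) ⊆ Set.Iic k := fun m k => by
    rw [queries_comp_of_eval _ (hpair m k), hsub.queries_eq, queries,
      queries_comp_of_eval (m := k) _ (by simp [eval])]
    simpa [queries] using hq k
  have hex : ∀ m : ℕ, ∃ k, m.unpair.2 ≤ g k := fun m => ⟨_, hg.id_le _⟩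
  have hfind : ∀ m, eval X (rfind test) m = Part.some (Nat.find (hex m)) := fun m => by
    refine Part.eq_some_iff.2 (Nat.mem_rfind.2 ⟨?_, fun {k} hk => ?_⟩)
    · simpa [htest, Nat.sub_eq_zero_iff_le] using Nat.find_spec (hex m)
    · simpa [htest, Nat.sub_eq_zero_iff_le] using Nat.find_min (hex m) hk
  have hfindq : ∀ m, ∀ q ∈ queries X (rfind test) m, ∀ k < q, g k < m.unpair.2 := by
    rintro m q ⟨n, hn, hq'⟩ k hk
    obtain ⟨v, hv, hv0⟩ := hn k (hk.trans_le (htestq m n hq'))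
    rw [htest, Part.mem_some_iff] at hv
    omega
  have hval : ∀ m, eval X (pair idc (pair (rfind test) (comp c (rfind test)))) m =
      Part.some (Nat.pair m (Nat.pair (Nat.find (hex m)) (g (Nat.find (hex m))))) := fun m =>
    eval_pair_of_eval (by simp [hid.eval_eq]) (eval_pair_of_eval (hfind m)
      ((eval_comp_of_eval _ (hfind m)).trans (hc _)))
  refine ⟨comp fin (pair idc (pair (rfind test) (comp c (rfind test)))), fun m => ?_, fun m => ?_⟩
  · rw [eval_comp_of_eval _ (hval m), hfin.eval_eq]
    -- By strict monotonicity, `g n = v` forces `n` to be the least `k` with `v ≤ g k`.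
    have hiff : m = Nat.pair (Nat.find (hex m)) (g (Nat.find (hex m))) ↔
        g m.unpair.1 = m.unpair.2 := by
      constructor
      · intro h
        rw [h]
        simp
      · intro h
        have : Nat.find (hex m) = m.unpair.1 := by
          refine (Nat.find_eq_iff _).2 ⟨h.ge, fun k hk => ?_⟩
          rw [← h, not_le]
          exact hg hk
        rw [this, h, Nat.pair_unpair]
    by_cases hm : g m.unpair.1 = m.unpair.2
    · simp [charFn, hm, ← hiff.2 hm]
    · simp [charFn, hm, hiff]
  · rw [queries_comp_of_eval _ (hval m), hfin.queries_eq, queries, queries, hid.queries_eq,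
      queries_comp_of_eval _ (hfind m)]
    simp only [Set.empty_union, Set.union_empty]
    rintro q (h | h | h) k hk
    · exact hfindq m q h k hk
    · exact hfindq m q h k hk
    · exact not_le.1 (Nat.find_min (hex m) (hk.trans_le (hq _ h)))

end OracleCode

/-- If all queries of a program are below the inverse of a dominant function, then its use is
dominated by every order function. -/
theorem eventually_use_le_of_isDominant {X g : ℕ → ℕ} (hg : IsDominant g) {d : OracleCode}
    (hd : ∀ m, ∀ q ∈ queries X d m, ∀ k < q, g k < m) {h : ℕ → ℕ} (hh : IsOrder h) :
    ∀ᶠ n in atTop, d.use X n ≤ h n := by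
  obtain ⟨hcomp, hmono, hunb⟩ := hh
  -- The shift by `2` serves a query `q = k + 1`, which contributes `q + 1 = k + 2` to the use. The
  -- least such `n` is recursive in `k`, so `g` dominates it.
  have hex : ∀ k, ∃ n, k + 2 ≤ h n := fun k => by
    by_contra! hlt
    exact hunb ⟨k + 2, by rintro _ ⟨n, rfl⟩; exact (hlt n).le⟩
  have hinv : Computable fun k => Nat.find (hex k) := by
    have hp : Computable₂ fun k n : ℕ => decide (k + 2 ≤ h n) :=
      (primrecPred_iff_primrec_decide.1 Primrec.nat_le).to_comp.comp
        (Computable.pair (Primrec.nat_add.comp Primrec.fst (Primrec.const 2)).to_comp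
          (hcomp.comp Computable.snd))
    refine (Partrec.rfind hp.partrec₂).of_eq fun k =>
      Part.eq_some_iff.2 (Nat.mem_rfind.2 ⟨?_, fun {m} hm => ?_⟩)
    · simpa using Nat.find_spec (hex k)
    · simpa using Nat.find_min (hex k) hm
  obtain ⟨K, hK⟩ := eventually_atTop.1 (hg _ hinv)
  obtain ⟨N, hN⟩ := hex K
  filter_upwards [eventually_ge_atTop N] with n hn
  refine use_le fun m hm q hq => ?_
  have hKn : K + 2 ≤ h n := hN.trans (hmono hn)
  rcases le_or_gt q K with hqK | hqK
  · omega
  · have h₁ := hd m q hq (q - 1) (by omega)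
    have h₂ := hK (q - 1) (by omega)
    have h₃ := Nat.find_spec (hex (q - 1))
    have h₄ : h (Nat.find (hex (q - 1))) ≤ h n := hmono (by omega)
    omega

/-- An unbounded search through the graph finds `g n`, whose parity is the required bit. -/
theorem turingReducible_graph_of_mod_two {g : ℕ → ℕ} {B : Set ℕ}
    (h : ∀ n, g n % 2 = charFn B n) :
    TuringReducible (charFn B : ℕ →. ℕ)
      (charFn {m : ℕ | g m.unpair.1 = m.unpair.2} : ℕ →. ℕ) := by
  obtain ⟨sub, hsub⟩ := exists_computesFreely_total (f := fun x => 1 - x)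
    (Primrec.nat_sub.comp (Primrec.const 1) Primrec.id).to_comp
  obtain ⟨par, hpar⟩ := exists_computesFreely_total (f := fun x => x % 2)
    (Primrec.nat_mod.comp Primrec.id (Primrec.const 2)).to_comp
  set X := charFn {m : ℕ | g m.unpair.1 = m.unpair.2}
  have htest : ∀ n v, eval X (comp sub oracle) (Nat.pair n v) =
      Part.some (if g n = v then 0 else 1) := fun n v => by
    rw [eval_comp_of_eval (m := X (Nat.pair n v)) _ rfl, hsub.eval_eq]
    by_cases hv : g n = v <;> simp [X, charFn, hv]
  have hfind : ∀ n, eval X (rfind (comp sub oracle)) n = Part.some (g n) := fun n => by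
    refine Part.eq_some_iff.2 (Nat.mem_rfind.2 ⟨?_, fun {k} hk => ?_⟩)
    · simp [htest]
    · simp [htest, hk.ne']
  refine (exists_code_iff X _).1 ⟨comp par (rfind (comp sub oracle)), funext fun n => ?_⟩
  rw [eval_comp_of_eval _ (hfind n), hpar.eval_eq]
  simp [h]

theorem wttReducible_of_mod_two {f g : ℕ → ℕ} (h : ∀ n, g n % 2 = f n) : WttReducible f g := by
  obtain ⟨par, hpar⟩ := exists_computesFreely_total (f := fun x => x % 2)
    (Primrec.nat_mod.comp Primrec.id (Primrec.const 2)).to_comp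
  have heval : ∀ n, eval g oracle n = Part.some (g n) := fun _ => rfl
  refine ⟨comp par oracle, fun n => ?_, id, Computable.id, fun n => use_le fun m hm q hq => ?_⟩
  · rw [eval_comp_of_eval _ (heval n), hpar.eval_eq]
    simp [h]
  · rw [queries_comp_of_eval _ (heval m), hpar.queries_eq, Set.union_empty] at hq
    obtain rfl : q = m := hq
    exact hm

theorem mainTheorem10 (a j : TuringDegree)
    (hj : IsLUB {a, degT (jump ∅)} j)
    (h : degT (jump (jump ∅)) ≤ j)
    (B : Set ℕ) (hB : degT B = a) :
    (∃ A : Set ℕ, degT A = a ∧ UniformTinyUseReducible A B) ∧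
      ∃ f : ℕ → ℕ, IsDominant f ∧ WttEquivalent f (charFn B) := by
  subst hB
  -- Only leastness of `j` is needed: the join of the functions bounds both degrees, so it computes
  -- `0''`.
  have hle : j ≤ toAntisymmetrization TuringReducible
      (joinFn (charFn B) (charFn (jump ∅)) : ℕ →. ℕ) := by
    refine hj.2 ?_
    rintro _ (rfl | rfl)
    · exact turingReducible_joinFn_left _ _
    · exact turingReducible_joinFn_right _ _
  obtain ⟨Γ, hΓ⟩ := (exists_code_iff _ _).2 (show TuringReducible
    (charFn (jump (jump ∅)) : ℕ →. ℕ) (joinFn (charFn B) (charFn (jump ∅)) : ℕ →. ℕ) from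
      h.trans hle)
  obtain ⟨G, g, hG, hmono, hdom, hGg, hmod⟩ := exists_dominant_of_computes_jump_jump
    (B := B) (Γ := Γ) fun n => by rw [hΓ]; rfl
  obtain ⟨c, hc, hq⟩ := exists_code_of_initSeg hG hGg
  obtain ⟨d, hd, hdq⟩ := exists_graph_code hmono hc hq
  refine ⟨⟨{m | g m.unpair.1 = m.unpair.2}, le_antisymm ?_ ?_, d, hd, fun o ho => ?_⟩,
    g, hdom, ⟨c, hc, id, Computable.id, fun n => ?_⟩, wttReducible_of_mod_two hmod⟩
  · exact (exists_code_iff _ _).1 ⟨d, funext hd⟩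
  · exact turingReducible_graph_of_mod_two hmod
  · exact eventually_use_le_of_isDominant hdom
      (fun m q hq k hk => (hdq m q hq k hk).trans_le m.unpair_right_le) ho
  · exact use_le fun m hm q hqm => (hq m hqm).trans_lt hm
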